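/- Let $E$ be a finite set and, for $i\in E$, let $F^i:\mathbb{R}^d\to\mathbb{R}^d$ be a $C^\infty$ vector field; assume $\sup_{x,i}\|F^i(x)\|<\infty$, and let $\Phi^i=(\Phi^i_t)$ be the flow of $F^i$. Let $M\subset\mathbb{R}^d$ be a compact set with $\Phi^i_t(M)\subset M$ for all $i\in E$ and $t\ge 0$. For $i,j\in E$ let $x\mapsto\lambda(x,i,j)$ be a continuous function on $M$, with $\lambda(x,i,j)\ge 0$ for $i\ne j$ and $\lambda(x,i,i)=0$, such that for every $x\in M$ the matrix $(\lambda(x,i,j))_{i,j}$ is irreducible (every index can be reached from every other one along positive entries). Fix $\lambda>0$ with $\sum_{j}\lambda(x,i,j)<\lambda$ for all $x\in M$, $i\in E$, and put $Q(x,i,j)=\lambda(x,i,j)/\lambda$ for $i\ne j$ and $Q(x,i,i)=1-\sum_{j\ne i}Q(x,i,j)$. Let $\tilde Z=(\tilde X_n,\tilde Y_n)_{n\ge 0}$ be the Markov chain on $M\times E$ for which, given $(\tilde X_n,\tilde Y_n)=(x,i)$, one has $\tilde X_{n+1}=\Phi^i_U(x)$ with $U$ exponential of parameter $\lambda$ and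 $\tilde Y_{n+1}=j$ with conditional probability $Q(\tilde X_{n+1},i,j)$; that is, its transition operator is $$\tilde P g(x,i)=\int_0^\infty \lambda e^{-\lambda t}\sum_{j\in E}Q(\Phi^i_t(x),i,j)\,g(\Phi^i_t(x),j)\,dt .$$ Let $\tilde{\mathcal P}_{inv}$ be the set of Borel probability measures $\mu$ on $M\times E$ that are invariant for $\tilde Z$, i.e. $\int\tilde P g\,d\mu=\int g\,d\mu$ for every continuous $g:M\times E\to\mathbb{R}$. The chain is called stable if $\tilde{\mathcal P}_{inv}$ has exactly one element. For $x\in M$ let $\gamma^+(x)$ be the set of all points $\Phi^{i_{n-1}}_{u_n}\circ\cdots\circ\Phi^{i_0}_{u_1}(x)$ with $n\ge 1$, $i_0,\dots,i_{n-1}\in E$ and $u_1,\dots,u_n\ge 0$, and let $$\Gamma=\Bigl\{p\in M : p\in\overline{\gamma^+(x)}\ \text{ for all } x\in M\Bigr\}$$ be the accessible set. Then: (i) If $\Gamma\neq\emptyset$, then $\Gamma\times E\subset\operatorname{supp}(\mu)$ for all $\mu\in\tilde{\mathcal P}_{inv}$, and there exists $\mu\in\tilde{\mathcal P}_{inv}$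 with $\operatorname{supp}(\mu)=\Gamma\times E$. (ii) If $\Gamma$ has nonempty interior (in $\mathbb{R}^d$), then $\operatorname{supp}(\mu)=\Gamma\times E$ for all $\mu\in\tilde{\mathcal P}_{inv}$. (iii) If $\tilde Z$ is stable, with invariant probability $\pi$, then $\operatorname{supp}(\pi)=\Gamma\times E$. -/

import Mathlib

open MeasureTheory Set Topology
open scoped NNReal

noncomputable section

namespace SwitchedPDMP

open Classical in
/-- The flow of a vector field `V` on `ℝᵈ`: `flow V t x` is the value at time `t` of the solution
of the Cauchy problem `γ' = V(γ)`, `γ(0) = x` on the whole line. Such a solution exists and is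
unique when `V` is smooth and bounded (see `flow_spec` for existence), so that the default value
is irrelevant below. -/
def flow {d : ℕ} (V : EuclideanSpace ℝ (Fin d) → EuclideanSpace ℝ (Fin d)) (t : ℝ)
    (x : EuclideanSpace ℝ (Fin d)) : EuclideanSpace ℝ (Fin d) :=
  if h : ∃ γ : ℝ → EuclideanSpace ℝ (Fin d), γ 0 = x ∧ ∀ s, HasDerivAt γ (V (γ s)) s
  then h.choose t else x

/-- For a smooth bounded vector field the Cauchy problem has a solution on the whole line. -/
theorem flow_spec {d : ℕ} (V : EuclideanSpace ℝ (Fin d) → EuclideanSpace ℝ (Fin d))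
    (hV : ContDiff ℝ (⊤ : ℕ∞) V) {C : ℝ} (hC : ∀ x, ‖V x‖ ≤ C) (x : EuclideanSpace ℝ (Fin d)) :
    flow V 0 x = x ∧ ∀ t, HasDerivAt (fun s => flow V s x) (V (flow V t x)) t := by
  have hV1 : ContDiff ℝ 1 V := hV.of_le (by exact_mod_cast le_top)
  have key : ∃ γ : ℝ → EuclideanSpace ℝ (Fin d), γ 0 = x ∧ ∀ s, HasDerivAt γ (V (γ s)) s := by
    have hC0 : 0 ≤ C := (norm_nonneg _).trans (hC 0)
    obtain ⟨γ, h0, h⟩ := exists_isMIntegralCurve_of_isMIntegralCurveOn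
      (I := modelWithCornersSelf ℝ (EuclideanSpace ℝ (Fin d)))
      (M := EuclideanSpace ℝ (Fin d)) (v := V)
      (contMDiff_vectorSpace_iff_contDiff.2 hV1) one_pos (fun y => by
        obtain ⟨K, hK⟩ := hV1.contDiffOn.exists_lipschitzOnWith one_ne_zero
          (convex_closedBall y C) (isCompact_closedBall y C)
        have hpl : IsPicardLindelof (fun _ => V) (tmin := -1) (tmax := 1)
            ⟨0, by norm_num⟩ y ⟨C, hC0⟩ 0 ⟨C, hC0⟩ K :=
          IsPicardLindelof.of_time_independent (fun z _ => hC z) hK (by simp)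
        obtain ⟨α, h0, hα⟩ := hpl.exists_eq_forall_mem_Icc_hasDerivWithinAt₀
        refine ⟨α, h0, fun t ht => ?_⟩
        exact ((hα t (Ioo_subset_Icc_self ht)).mono Ioo_subset_Icc_self
          ).hasFDerivWithinAt.hasMFDerivWithinAt) x
    refine ⟨γ, h0, fun s => ?_⟩
    have h2 : HasFDerivAt γ ((1 : ℝ →L[ℝ] ℝ).smulRight (V (γ s))) s := (h s).hasFDerivAt
    simpa using h2.hasDerivAt
  have e : (fun s => flow V s x) = key.choose := by
    funext s
    simp only [flow, dif_pos key]
  have hs := key.choose_spec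
  rw [← e] at hs
  exact hs

/-- The data of the switched process on `M × E`. -/
structure Model (d : ℕ) (E : Type*) [Fintype E] where
  /-- the vector fields `Fⁱ` -/
  F : E → EuclideanSpace ℝ (Fin d) → EuclideanSpace ℝ (Fin d)
  smooth : ∀ i, ContDiff ℝ (⊤ : ℕ∞) (F i)
  bounded : ∃ C : ℝ, ∀ i x, ‖F i x‖ ≤ C
  /-- the compact set `M` -/
  M : Set (EuclideanSpace ℝ (Fin d))
  isCompact_M : IsCompact M
  flow_mem : ∀ i (t : ℝ), 0 ≤ t → ∀ x ∈ M, flow (F i) t x ∈ M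
  /-- the jump rates `λ(x,i,j)` -/
  rate : M → E → E → ℝ
  rate_continuous : ∀ i j, Continuous fun x => rate x i j
  rate_nonneg : ∀ x i j, i ≠ j → 0 ≤ rate x i j
  rate_self : ∀ x i, rate x i i = 0
  /-- irreducibility of the matrix `(λ(x,i,j))` for each `x` -/
  rate_irreducible : ∀ x i j, Relation.ReflTransGen (fun a b => 0 < rate x a b) i j
  /-- the intensity `λ` of the Poisson clock, larger than every total jump rate -/
  lam : ℝ
  lam_pos : 0 < lam
  sum_rate_lt : ∀ x i, ∑ j, rate x i j < lam

namespace Model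

variable {d : ℕ} {E : Type*} [Fintype E] (D : Model d E)

/-- The semiflow `Φⁱₜ : M → M`, `t ≥ 0`. -/
def Phi (i : E) (t : ℝ≥0) (x : D.M) : D.M :=
  ⟨flow (D.F i) t x, D.flow_mem i t t.2 x x.2⟩

open Classical in
/-- The jump matrix: `Q(x,i,j) = λ(x,i,j)/λ` for `i ≠ j`, `Q(x,i,i) = 1 - ∑_{j ≠ i} Q(x,i,j)`. -/
def Q (x : D.M) (i j : E) : ℝ :=
  if i = j then 1 - ∑ k ∈ Finset.univ.erase i, D.rate x i k / D.lam
  else D.rate x i j / D.lam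

/-- The operator `Q g(x,i) = ∑ⱼ Q(x,i,j) g(x,j)`. -/
def jumpOp (g : D.M × E → ℝ) (z : D.M × E) : ℝ := ∑ j, D.Q z.1 z.2 j * g (z.1, j)

/-- The operator `K_t g(x,i) = g(Φⁱₜ(x),i)`. -/
def flowOp (t : ℝ≥0) (g : D.M × E → ℝ) (z : D.M × E) : ℝ := g (D.Phi z.2 t z.1, z.2)

/-- The transition operator of the embedded chain `Z̃`,
`P̃ g(x,i) = 𝔼[g(Z̃₁) | Z̃₀ = (x,i)] = ∫₀^∞ K_t Q g(x,i) λ e^{-λt} dt`: from `(x,i)` the chain follows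
the flow `Φⁱ` during an exponential time of parameter `λ`, and then draws the new index
according to the row `i` of `Q` at the point that has been reached. -/
def transitionOp (g : D.M × E → ℝ) (z : D.M × E) : ℝ :=
  ∫ t in Ioi (0 : ℝ), D.flowOp t.toNNReal (D.jumpOp g) z * (D.lam * Real.exp (-D.lam * t))

/-- Invariant probability measures of `Z̃`: `μ P̃ = μ`, where `μ P̃` is defined by duality
against continuous functions on the compact space `M × E`. -/
def IsInvariant [TopologicalSpace E] [MeasurableSpace E] (μ : Measure (D.M × E)) : Prop :=
  IsProbabilityMeasure μ ∧
    ∀ g : C(D.M × E, ℝ), ∫ z, D.transitionOp g z ∂μ = ∫ z, g z ∂μ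

/-- The chain `Z̃` is stable if it has a unique invariant probability measure. -/
def IsStable [TopologicalSpace E] [MeasurableSpace E] : Prop :=
  ∃! μ : Measure (D.M × E), D.IsInvariant μ

/-- The composite flow `Φ^{i_{n-1}}_{u_n} ∘ ⋯ ∘ Φ^{i_0}_{u_1}` encoded by the list
`[(i_0,u_1), …, (i_{n-1},u_n)]`. -/
def composite (l : List (E × ℝ≥0)) (x : D.M) : D.M :=
  l.foldl (fun y p => D.Phi p.1 p.2 y) x

/-- The positive orbit `γ⁺(x)`, as a subset of `ℝᵈ`. -/
def orbit (x : D.M) : Set (EuclideanSpace ℝ (Fin d)) :=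
  {y | ∃ l : List (E × ℝ≥0), l ≠ [] ∧ (D.composite l x : EuclideanSpace ℝ (Fin d)) = y}

/-- The accessible set `Γ ⊆ M`, the points of `M` that lie in the closure of `γ⁺(x)` for every
`x ∈ M`. -/
def accessible : Set (EuclideanSpace ℝ (Fin d)) :=
  D.M ∩ ⋂ x : D.M, closure (D.orbit x)

/-- The set `Γ × E` as a subset of the state space `M × E`. -/
def accessibleProd : Set (D.M × E) := {z | (z.1 : EuclideanSpace ℝ (Fin d)) ∈ D.accessible}

end Model

end SwitchedPDMP

end

/-!
Call a closed nonempty set `S ⊆ M × E` absorbing if the chain started in `S` never leaves it. The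
support of an invariant probability measure is absorbing. Conversely, every absorbing set carries an
invariant probability measure: at a minimum point of `f` over `S` one has `P̃ f - f ≥ 0`, so the
sublinear functional `sup_S` is nonnegative on the range of `P̃ - 1`, and the Hahn–Banach theorem
yields an invariant functional below `sup_S`.

By irreducibility an absorbing set is stable under changes of the index, and since `Q(x,i,i) > 0` it
is stable under all flows, so it contains `γ⁺(x) × E` for some `x`. As `closure γ⁺(x) × E` is itself
absorbing, `Γ × E` is the intersection of all absorbing sets; if it is nonempty, it is the least
one. This gives (i). In the stable case the support of `π` is the least absorbing set, which is
(iii). For (ii), if `μ` charged the complement of `Γ × E`, then its restriction to this complement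
would again be invariant, so its support would contain `Γ × E`, although it does not charge the
interior of `Γ × E`.
-/

open Filter

noncomputable section

namespace SwitchedPDMP

section PositiveOperators

variable {X : Type*} [TopologicalSpace X] {P : C(X, ℝ) →ₚ[ℝ] C(X, ℝ)} {S : Set X}

/-- A set `S` is absorbing for a positive operator `P` on `C(X, ℝ)` if on `S` the function `P f`
depends only on the values of `f` on `S`. For the transition operator of a Markov chain and `S`
closed, this says that the chain started in `S` never leaves `S`. -/
def IsAbsorbing (P : C(X, ℝ) →ₚ[ℝ] C(X, ℝ)) (S : Set X) : Prop :=
  ∀ ⦃f g : C(X, ℝ)⦄, EqOn f g S → EqOn (P f) (P g) S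

/-- The nonempty closed absorbing sets of a positive operator `P` on `C(X, ℝ)`. -/
def closedAbsorbingSets (P : C(X, ℝ) →ₚ[ℝ] C(X, ℝ)) : Set (Set X) :=
  {S | IsClosed S ∧ S.Nonempty ∧ IsAbsorbing P S}

/-- A measure `μ` is invariant for an operator `P` on `C(X, ℝ)` if `μ P = μ`, where `μ P` is defined
by duality against continuous functions. -/
def IsInvariantMeasure [MeasurableSpace X] (P : C(X, ℝ) →ₚ[ℝ] C(X, ℝ)) (μ : Measure X) : Prop :=
  ∀ f : C(X, ℝ), ∫ x, P f x ∂μ = ∫ x, f x ∂μ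

theorem abs_apply_le_apply_abs (P : C(X, ℝ) →ₚ[ℝ] C(X, ℝ)) (f : C(X, ℝ)) : |P f| ≤ P |f| :=
  abs_le'.2 ⟨OrderHomClass.mono P (le_abs_self f),
    (map_neg P f).symm.trans_le (OrderHomClass.mono P (neg_le_abs f))⟩

theorem IsAbsorbing.le_apply (hP : P 1 = 1) (hS : IsAbsorbing P S) {f : C(X, ℝ)} {c : ℝ}
    (hf : ∀ x ∈ S, c ≤ f x) {x : X} (hx : x ∈ S) : c ≤ P f x := by
  have hsup : EqOn f (f ⊔ c • 1 : C(X, ℝ)) S := fun y hy => by simp [hf y hy]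
  have hmono : P (c • 1) ≤ P (f ⊔ c • 1) := OrderHomClass.mono P le_sup_right
  rw [map_smul, hP] at hmono
  simpa [hS hsup hx] using hmono x

theorem exists_nonneg_eqOn_zero_of_notMem [NormalSpace X] [T1Space X] (hS : IsClosed S) {x : X}
    (hx : x ∉ S) : ∃ g : C(X, ℝ), 0 ≤ g ∧ EqOn g 0 S ∧ g x = 1 := by
  obtain ⟨g, hgS, hgx, hg⟩ := exists_continuous_zero_one_of_isClosed hS isClosed_singleton
    (disjoint_singleton_right.2 hx)
  exact ⟨g, fun y => (hg y).1, hgS, hgx rfl⟩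

section SupOn

/-- The supremum of a continuous function over a set, as a functional on `C(X, ℝ)`. It is sublinear
when the set is compact and nonempty. -/
def supOn (S : Set X) (f : C(X, ℝ)) : ℝ := sSup (f '' S)

theorem le_supOn (hS : IsCompact S) (f : C(X, ℝ)) {x : X} (hx : x ∈ S) : f x ≤ supOn S f :=
  le_csSup (hS.bddAbove_image f.continuous.continuousOn) (mem_image_of_mem f hx)

theorem supOn_le (hS : S.Nonempty) {f : C(X, ℝ)} {c : ℝ} (hf : ∀ x ∈ S, f x ≤ c) :
    supOn S f ≤ c :=
  csSup_le (hS.image f) (forall_mem_image.2 hf)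

theorem supOn_smul {c : ℝ} (hc : 0 ≤ c) (f : C(X, ℝ)) : supOn S (c • f) = c * supOn S f := by
  rw [supOn, supOn, ← smul_eq_mul, ← Real.sSup_smul_of_nonneg hc, ← image_smul, image_image]
  rfl

theorem supOn_add_le (hS : IsCompact S) (hne : S.Nonempty) (f g : C(X, ℝ)) :
    supOn S (f + g) ≤ supOn S f + supOn S g :=
  supOn_le hne fun _ hx => add_le_add (le_supOn hS f hx) (le_supOn hS g hx)

theorem IsAbsorbing.supOn_apply_sub_nonneg (hP : P 1 = 1) (hA : IsAbsorbing P S)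
    (hS : IsCompact S) (hne : S.Nonempty) (f : C(X, ℝ)) : 0 ≤ supOn S (P f - f) := by
  obtain ⟨x, hx, hmin⟩ := hS.exists_isMinOn hne f.continuous.continuousOn
  have hle : f x ≤ P f x := hA.le_apply hP (fun y hy => hmin hy) hx
  exact (sub_nonneg.2 hle).trans (le_supOn hS (P f - f) hx)

/-- The Hahn–Banach theorem extends the zero functional from the range of `P - 1`. -/
theorem IsAbsorbing.exists_invariant_functional_le_supOn (hP : P 1 = 1) (hA : IsAbsorbing P S)
    (hS : IsCompact S) (hne : S.Nonempty) :
    ∃ L : C(X, ℝ) →ₗ[ℝ] ℝ, (∀ f, L (P f) = L f) ∧ ∀ f, L f ≤ supOn S f := by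
  let zeroOnRange : C(X, ℝ) →ₗ.[ℝ] ℝ := ⟨LinearMap.range (P.toLinearMap - LinearMap.id), 0⟩
  obtain ⟨L, hLrange, hL⟩ := exists_extension_of_le_sublinear zeroOnRange (supOn S)
    (fun c hc => supOn_smul hc.le) (supOn_add_le hS hne) (by
      rintro ⟨_, f, rfl⟩
      exact hA.supOn_apply_sub_nonneg hP hS hne f)
  refine ⟨L, fun f => ?_, hL⟩
  have hzero : L (P f - f) = 0 := hLrange ⟨P f - f, f, rfl⟩
  rwa [map_sub, sub_eq_zero] at hzero

/-- By the Riesz–Markov–Kakutani theorem: `L ≤ sup_S` makes `L` positive, gives `L 1 = 1`, and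
makes `L` vanish on the functions that vanish on `S`. -/
theorem exists_isProbabilityMeasure_integral_eq_of_le_supOn [CompactSpace X] [T2Space X]
    [MeasurableSpace X] [BorelSpace X] (hne : S.Nonempty)
    (L : C(X, ℝ) →ₗ[ℝ] ℝ) (hL : ∀ f, L f ≤ supOn S f) :
    ∃ μ : Measure X, IsProbabilityMeasure μ ∧ ∀ f : C(X, ℝ), ∫ x, f x ∂μ = L f := by
  have hL_le {f : C(X, ℝ)} {c : ℝ} (hf : ∀ x ∈ S, f x ≤ c) : L f ≤ c :=
    (hL f).trans (supOn_le hne hf)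
  have hL_nonneg (f : C(X, ℝ)) (hf : 0 ≤ f) : 0 ≤ L f := by
    have : L (-f) ≤ 0 := hL_le fun x _ => neg_nonpos.2 (hf x)
    rwa [map_neg, neg_nonpos] at this
  have hL_one : L 1 = 1 := by
    have : L (-1) ≤ -1 := hL_le fun x _ => le_rfl
    rw [map_neg, neg_le_neg_iff] at this
    exact (hL_le fun x _ => le_rfl).antisymm this
  let Λ : CompactlySupportedContinuousMap X ℝ →ₚ[ℝ] ℝ := PositiveLinearMap.mk₀
    { toFun f := L f.toContinuousMap
      map_add' f g := map_add L f.toContinuousMap g.toContinuousMap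
      map_smul' c f := map_smul L c f.toContinuousMap } fun f hf => hL_nonneg f.toContinuousMap hf
  have hΛ (f : C(X, ℝ)) : ∫ x, f x ∂(RealRMK.rieszMeasure Λ) = L f :=
    RealRMK.integral_rieszMeasure Λ (CompactlySupportedContinuousMap.continuousMapEquiv f)
  refine ⟨RealRMK.rieszMeasure Λ, isProbabilityMeasure_iff_real.2 ?_, hΛ⟩
  simpa [hL_one] using hΛ 1

end SupOn

section Invariant

variable [MeasurableSpace X] {μ : Measure X}

theorem eqOn_support_zero_of_integral_eq_zero {g : X → ℝ} (hg : Continuous g) (h0 : 0 ≤ g)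
    (hi : Integrable g μ) (h : ∫ x, g x ∂μ = 0) : EqOn g 0 μ.support := by
  intro x hx
  by_contra hgx
  have hnull : μ {y | g y ≠ 0} = 0 := (integral_eq_zero_iff_of_nonneg h0 hi).1 h
  exact Measure.subset_compl_support_of_isOpen (isOpen_ne_fun hg continuous_const) hnull hgx hx

variable [CompactSpace X]

theorem integrable_continuousMap [OpensMeasurableSpace X] [IsFiniteMeasureOnCompacts μ]
    (f : C(X, ℝ)) : Integrable f μ :=
  f.continuous.integrable_of_hasCompactSupport (HasCompactSupport.of_compactSpace f)

theorem IsAbsorbing.exists_isInvariantMeasure_support_subset [T2Space X] [BorelSpace X]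
    (hP : P 1 = 1) (hA : IsAbsorbing P S) (hS : IsClosed S) (hne : S.Nonempty) :
    ∃ μ : Measure X, IsProbabilityMeasure μ ∧ IsInvariantMeasure P μ ∧ μ.support ⊆ S := by
  obtain ⟨L, hLP, hL⟩ := hA.exists_invariant_functional_le_supOn hP hS.isCompact hne
  obtain ⟨μ, hprob, hμ⟩ := exists_isProbabilityMeasure_integral_eq_of_le_supOn hne L hL
  refine ⟨μ, hprob, fun f => by rw [hμ, hμ, hLP], fun x hx => ?_⟩
  by_contra hxS
  obtain ⟨g, hg, hgS, hgx⟩ := exists_nonneg_eqOn_zero_of_notMem hS hxS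
  have hint : ∫ y, g y ∂μ = 0 := by
    refine le_antisymm ?_ (integral_nonneg hg)
    exact (hμ g).trans_le ((hL g).trans (supOn_le hne fun y hy => (hgS hy).le))
  have hzero := eqOn_support_zero_of_integral_eq_zero g.continuous hg
    (integrable_continuousMap g) hint hx
  exact one_ne_zero (hgx.symm.trans hzero)

theorem IsInvariantMeasure.isAbsorbing_support [OpensMeasurableSpace X]
    [HereditarilyLindelofSpace X] [IsFiniteMeasureOnCompacts μ] (hμ : IsInvariantMeasure P μ) :
    IsAbsorbing P μ.support := by
  intro f g hfg x hx
  have hint : ∫ y, P |f - g| y ∂μ = 0 := by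
    rw [hμ]
    refine integral_eq_zero_of_ae (mem_of_superset Measure.support_mem_ae fun y hy => ?_)
    simp [hfg hy]
  have hzero : P |f - g| x = 0 := eqOn_support_zero_of_integral_eq_zero (P |f - g|).continuous
    (PositiveLinearMap.map_nonneg P (abs_nonneg (f - g))) (integrable_continuousMap _) hint hx
  have habs : |P (f - g) x| ≤ P |f - g| x := abs_apply_le_apply_abs P (f - g) x
  rw [hzero, abs_nonpos_iff, map_sub] at habs
  exact sub_eq_zero.1 habs

theorem IsInvariantMeasure.support_mem_closedAbsorbingSets [OpensMeasurableSpace X]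
    [HereditarilyLindelofSpace X] [IsFiniteMeasureOnCompacts μ] (hμ : IsInvariantMeasure P μ)
    (h0 : μ ≠ 0) : μ.support ∈ closedAbsorbingSets P :=
  ⟨Measure.isClosed_support, Measure.nonempty_support h0, hμ.isAbsorbing_support⟩

theorem isLeast_support_of_unique_isInvariantMeasure [T2Space X] [BorelSpace X]
    [HereditarilyLindelofSpace X] [IsProbabilityMeasure μ] (hP : P 1 = 1)
    (hμ : IsInvariantMeasure P μ)
    (huniq : ∀ ν : Measure X, IsProbabilityMeasure ν → IsInvariantMeasure P ν → ν = μ) :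
    IsLeast (closedAbsorbingSets P) μ.support := by
  refine ⟨hμ.support_mem_closedAbsorbingSets (IsProbabilityMeasure.ne_zero μ), ?_⟩
  rintro S ⟨hS, hne, hA⟩
  obtain ⟨ν, hprob, hν, hνS⟩ := hA.exists_isInvariantMeasure_support_subset hP hS hne
  rwa [← huniq ν hprob hν]

section Restrict

variable [BorelSpace X] [HasOuterApproxClosed X] [IsFiniteMeasure μ]

theorem exists_seq_tendsto_setIntegral_of_isClosed (hS : IsClosed S) {f : C(X, ℝ)} (hf : 0 ≤ f) :
    ∃ θ : ℕ → C(X, ℝ), (∀ n, 0 ≤ θ n) ∧ (∀ n, EqOn (θ n) f S) ∧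
      Tendsto (fun n => ∫ x, θ n x ∂μ) atTop (𝓝 (∫ x in S, f x ∂μ)) := by
  let χ (n : ℕ) : C(X, ℝ) := ⟨fun x => hS.apprSeq n x, by fun_prop⟩
  have hχ_nonneg (n : ℕ) (x : X) : 0 ≤ χ n x := (hS.apprSeq n x).2
  have hχ_le (n : ℕ) (x : X) : χ n x ≤ 1 := HasOuterApproxClosed.apprSeq_apply_le_one hS n x
  have hχ_tendsto (x : X) : Tendsto (fun n => f x * χ n x) atTop (𝓝 (S.indicator f x)) := by
    have h := (NNReal.continuous_coe.tendsto _).comp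
      (tendsto_pi_nhds.1 (HasOuterApproxClosed.tendsto_apprSeq hS) x)
    have hind : S.indicator f x = f x * ((S.indicator (fun _ => 1) x : ℝ≥0) : ℝ) := by
      by_cases hx : x ∈ S <;> simp [hx]
    rw [hind]
    exact h.const_mul (f x)
  refine ⟨fun n => f * χ n, fun n x => mul_nonneg (hf x) (hχ_nonneg n x), fun n x hx => ?_, ?_⟩
  · simp [χ, HasOuterApproxClosed.apprSeq_apply_eq_one hS n hx]
  · rw [← integral_indicator hS.measurableSet]
    refine tendsto_integral_of_dominated_convergence f
      (fun n => (f * χ n).continuous.aestronglyMeasurable) (integrable_continuousMap f)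
      (fun n => Eventually.of_forall fun x => ?_) (Eventually.of_forall hχ_tendsto)
    calc ‖f x * χ n x‖ = f x * χ n x := Real.norm_of_nonneg (mul_nonneg (hf x) (hχ_nonneg n x))
      _ ≤ f x := mul_le_of_le_one_right (hf x) (hχ_le n x)

theorem IsInvariantMeasure.setIntegral_apply_le (hμ : IsInvariantMeasure P μ)
    (hA : IsAbsorbing P S) (hS : IsClosed S) {f : C(X, ℝ)} (hf : 0 ≤ f) :
    ∫ x in S, P f x ∂μ ≤ ∫ x in S, f x ∂μ := by
  obtain ⟨θ, hθ, hθf, hlim⟩ := exists_seq_tendsto_setIntegral_of_isClosed (μ := μ) hS hf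
  refine ge_of_tendsto' hlim fun n => ?_
  calc ∫ x in S, P f x ∂μ = ∫ x in S, P (θ n) x ∂μ :=
        setIntegral_congr_fun hS.measurableSet (hA (hθf n)).symm
    _ ≤ ∫ x, P (θ n) x ∂μ := setIntegral_le_integral (integrable_continuousMap _)
        (Eventually.of_forall (PositiveLinearMap.map_nonneg P (hθ n)))
    _ = ∫ x, θ n x ∂μ := hμ (θ n)

theorem IsInvariantMeasure.restrict (hP : P 1 = 1) (hμ : IsInvariantMeasure P μ)
    (hA : IsAbsorbing P S) (hS : IsClosed S) : IsInvariantMeasure P (μ.restrict S) := by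
  have hle (f : C(X, ℝ)) : ∫ x in S, P f x ∂μ ≤ ∫ x in S, f x ∂μ := by
    have hshift : 0 ≤ f + ‖f‖ • 1 := fun x => by
      have := f.neg_norm_le_apply x
      change 0 ≤ f x + ‖f‖ * 1
      linarith
    have h := hμ.setIntegral_apply_le hA hS hshift
    simp only [map_add, map_smul, hP, ContinuousMap.add_apply] at h
    rwa [integral_add (integrable_continuousMap _) (integrable_continuousMap _),
      integral_add (integrable_continuousMap _) (integrable_continuousMap _),
      add_le_add_iff_right] at h
  refine fun f => (hle f).antisymm ?_
  simpa [integral_neg] using hle (-f)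

theorem IsInvariantMeasure.restrict_compl (hP : P 1 = 1) (hμ : IsInvariantMeasure P μ)
    (hA : IsAbsorbing P S) (hS : IsClosed S) : IsInvariantMeasure P (μ.restrict Sᶜ) := fun f => by
  rw [setIntegral_compl hS.measurableSet (integrable_continuousMap _),
    setIntegral_compl hS.measurableSet (integrable_continuousMap _), hμ f,
    hμ.restrict hP hA hS f]

/-- Otherwise the restriction of `μ` to `Sᶜ` would be a nonzero invariant measure, whose support
would contain `S` although it does not charge the interior of `S`. -/
theorem IsInvariantMeasure.measure_compl_eq_zero_of_isLeast [HereditarilyLindelofSpace X]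
    (hP : P 1 = 1) (hμ : IsInvariantMeasure P μ) (hS : IsLeast (closedAbsorbingSets P) S)
    (hint : (interior S).Nonempty) : μ Sᶜ = 0 := by
  obtain ⟨hcl, -, hA⟩ := hS.1
  by_contra h0
  have hmem := (hμ.restrict_compl hP hA hcl).support_mem_closedAbsorbingSets
    (Measure.restrict_eq_zero.not.2 h0)
  obtain ⟨x, hx⟩ := hint
  refine Measure.subset_compl_support_of_isOpen isOpen_interior ?_ hx
    (hS.2 hmem (interior_subset hx))
  rw [Measure.restrict_apply isOpen_interior.measurableSet,
    (disjoint_compl_right.mono_left interior_subset).inter_eq, measure_empty]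

theorem IsInvariantMeasure.support_eq_of_isLeast [HereditarilyLindelofSpace X] (hP : P 1 = 1)
    (hμ : IsInvariantMeasure P μ) (h0 : μ ≠ 0) (hS : IsLeast (closedAbsorbingSets P) S)
    (hint : (interior S).Nonempty) : μ.support = S :=
  (Measure.support_subset_of_isClosed hS.1.1
    (hμ.measure_compl_eq_zero_of_isLeast hP hS hint)).antisymm
    (hS.2 (hμ.support_mem_closedAbsorbingSets h0))

end Restrict

end Invariant

end PositiveOperators

section Flow

variable {d : ℕ} {V : EuclideanSpace ℝ (Fin d) → EuclideanSpace ℝ (Fin d)}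

theorem continuous_flow_time (hV : ContDiff ℝ (⊤ : ℕ∞) V) {C : ℝ} (hC : ∀ x, ‖V x‖ ≤ C)
    (x : EuclideanSpace ℝ (Fin d)) : Continuous fun t => flow V t x :=
  continuous_iff_continuousAt.2 fun t => ((flow_spec V hV hC x).2 t).continuousAt

theorem dist_flow_le (hV : ContDiff ℝ (⊤ : ℕ∞) V) {C : ℝ} (hC : ∀ x, ‖V x‖ ≤ C)
    {s : Set (EuclideanSpace ℝ (Fin d))} {K : ℝ≥0} (hK : LipschitzOnWith K V s) {t : ℝ}
    (ht : 0 ≤ t) {x y : EuclideanSpace ℝ (Fin d)} (hx : ∀ u ∈ Ico 0 t, flow V u x ∈ s)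
    (hy : ∀ u ∈ Ico 0 t, flow V u y ∈ s) :
    dist (flow V t x) (flow V t y) ≤ dist x y * Real.exp (K * t) := by
  have hspec := flow_spec V hV hC
  have h0 : dist (flow V 0 x) (flow V 0 y) ≤ dist x y := by rw [(hspec x).1, (hspec y).1]
  simpa only [sub_zero] using dist_le_of_trajectories_ODE_of_mem (fun _ _ => hK)
    (continuous_flow_time hV hC x).continuousOn
    (fun u _ => ((hspec x).2 u).hasDerivWithinAt) hx
    (continuous_flow_time hV hC y).continuousOn
    (fun u _ => ((hspec y).2 u).hasDerivWithinAt) hy h0 t ⟨ht, le_rfl⟩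

end Flow

theorem eqOn_Ici_zero_of_setIntegral_Ioi_eq_zero {f : ℝ → ℝ} {a : ℝ} (hf : Continuous f)
    (h0 : 0 ≤ f) (hi : IntegrableOn f (Ioi a)) (h : ∫ t in Ioi a, f t = 0) :
    EqOn f 0 (Ici a) := by
  have hae : f =ᵐ[volume.restrict (Ici a)] 0 := by
    rw [← restrict_Ioi_eq_restrict_Ici]
    exact (integral_eq_zero_iff_of_nonneg h0 hi).1 h
  exact Measure.eqOn_of_ae_eq hae hf.continuousOn continuousOn_const
    (by rw [interior_Ici, closure_Ioi])

namespace Model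

variable {d : ℕ} {E : Type*} [Fintype E] (D : Model d E)

instance : CompactSpace D.M := isCompact_iff_compactSpace.1 D.isCompact_M

theorem Phi_zero (i : E) (x : D.M) : D.Phi i 0 x = x := by
  obtain ⟨C, hC⟩ := D.bounded
  exact Subtype.ext (flow_spec (D.F i) (D.smooth i) (hC i) x).1

theorem continuous_Phi_time (i : E) (x : D.M) : Continuous fun t : ℝ≥0 => D.Phi i t x := by
  obtain ⟨C, hC⟩ := D.bounded
  exact ((continuous_flow_time (D.smooth i) (hC i) x).comp NNReal.continuous_coe).subtype_mk _

theorem continuous_Phi_space (i : E) (t : ℝ≥0) : Continuous (D.Phi i t) := by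
  obtain ⟨C, hC⟩ := D.bounded
  obtain ⟨R, hR⟩ := D.isCompact_M.isBounded.subset_closedBall 0
  obtain ⟨K, hK⟩ := (D.smooth i).contDiffOn.exists_lipschitzOnWith (by simp)
    (convex_closedBall 0 R) (isCompact_closedBall 0 R)
  have hmem (x : D.M) : ∀ s ∈ Ico (0 : ℝ) t, flow (D.F i) s x ∈ D.M :=
    fun s hs => D.flow_mem i s hs.1 x x.2
  refine (LipschitzWith.of_dist_le_mul (K := (Real.exp (K * t)).toNNReal) fun x y => ?_).continuous
  rw [Real.coe_toNNReal _ (Real.exp_pos _).le, mul_comm]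
  exact dist_flow_le (D.smooth i) (hC i) (hK.mono hR) t.2 (hmem x) (hmem y)

section JumpMatrix

theorem Q_of_ne (x : D.M) {i j : E} (h : i ≠ j) : D.Q x i j = D.rate x i j / D.lam := by
  simp [Q, h]

theorem Q_self (x : D.M) (i : E) : D.Q x i i = 1 - ∑ k, D.rate x i k / D.lam := by
  classical
  rw [← Finset.add_sum_erase _ _ (Finset.mem_univ i), D.rate_self]
  simp only [Q, if_true, zero_div, zero_add]

theorem Q_self_pos (x : D.M) (i : E) : 0 < D.Q x i i := by
  rw [Q_self, ← Finset.sum_div, sub_pos, div_lt_one D.lam_pos]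
  exact D.sum_rate_lt x i

theorem Q_nonneg (x : D.M) (i j : E) : 0 ≤ D.Q x i j := by
  rcases eq_or_ne i j with rfl | h
  · exact (D.Q_self_pos x i).le
  · rw [D.Q_of_ne x h]
    exact div_nonneg (D.rate_nonneg x i j h) D.lam_pos.le

theorem Q_pos_of_rate_pos {x : D.M} {i j : E} (h : 0 < D.rate x i j) : 0 < D.Q x i j := by
  have hij : i ≠ j := by
    rintro rfl
    exact h.ne' (D.rate_self x i)
  rw [D.Q_of_ne x hij]
  exact div_pos h D.lam_pos

theorem sum_Q (x : D.M) (i : E) : ∑ j, D.Q x i j = 1 := by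
  classical
  rw [← Finset.add_sum_erase _ _ (Finset.mem_univ i),
    Finset.sum_congr rfl fun j hj => D.Q_of_ne x (Finset.ne_of_mem_erase hj).symm, Q_self,
    ← Finset.add_sum_erase _ _ (Finset.mem_univ i), D.rate_self]
  ring

theorem continuous_Q (i j : E) : Continuous fun x => D.Q x i j := by
  have hrate (k : E) : Continuous fun x => D.rate x i k / D.lam :=
    (D.rate_continuous i k).div_const _
  rcases eq_or_ne i j with rfl | h
  · simp only [Q_self]
    exact continuous_const.sub (continuous_finsetSum _ fun k _ => hrate k)
  · simpa only [D.Q_of_ne _ h] using hrate j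

theorem jumpOp_nonneg {g : D.M × E → ℝ} (hg : 0 ≤ g) : 0 ≤ D.jumpOp g := fun _ =>
  Finset.sum_nonneg fun j _ => mul_nonneg (D.Q_nonneg _ _ j) (hg _)

theorem abs_jumpOp_le {g : D.M × E → ℝ} {C : ℝ} (hg : ∀ z, |g z| ≤ C) (z : D.M × E) :
    |D.jumpOp g z| ≤ C := by
  calc |D.jumpOp g z| ≤ ∑ j, |D.Q z.1 z.2 j * g (z.1, j)| := Finset.abs_sum_le_sum_abs _ _
    _ ≤ ∑ j, D.Q z.1 z.2 j * C := Finset.sum_le_sum fun j _ => by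
        rw [abs_mul, abs_of_nonneg (D.Q_nonneg _ _ _)]
        exact mul_le_mul_of_nonneg_left (hg _) (D.Q_nonneg _ _ _)
    _ = C := by rw [← Finset.sum_mul, sum_Q, one_mul]

theorem jumpOp_add (f g : D.M × E → ℝ) : D.jumpOp (f + g) = D.jumpOp f + D.jumpOp g := by
  ext z
  simp only [jumpOp, Pi.add_apply, mul_add, Finset.sum_add_distrib]

theorem jumpOp_smul (c : ℝ) (g : D.M × E → ℝ) : D.jumpOp (c • g) = c • D.jumpOp g := by
  ext z
  simp only [jumpOp, Pi.smul_apply, smul_eq_mul, Finset.mul_sum, mul_left_comm]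

theorem jumpOp_one : D.jumpOp 1 = 1 := by
  ext z
  simp only [jumpOp, Pi.one_apply, mul_one, sum_Q]

theorem eq_zero_of_jumpOp_eq_zero {g : D.M × E → ℝ} (hg : 0 ≤ g) {x : D.M} {i j : E}
    (h : D.jumpOp g (x, i) = 0) (hQ : 0 < D.Q x i j) : g (x, j) = 0 := by
  have hterm := (Finset.sum_eq_zero_iff_of_nonneg fun k _ =>
    mul_nonneg (D.Q_nonneg x i k) (hg _)).1 h j (Finset.mem_univ j)
  exact (mul_eq_zero.1 hterm).resolve_left hQ.ne'

end JumpMatrix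

section Clock

/-- The density of the exponential clock of parameter `λ` that triggers the jumps. -/
def clockDensity (t : ℝ) : ℝ := D.lam * Real.exp (-D.lam * t)

theorem clockDensity_pos (t : ℝ) : 0 < D.clockDensity t := mul_pos D.lam_pos (Real.exp_pos _)

theorem continuous_clockDensity : Continuous D.clockDensity := by
  unfold clockDensity
  fun_prop

theorem integrableOn_clockDensity : IntegrableOn D.clockDensity (Ioi 0) :=
  (exp_neg_integrableOn_Ioi 0 D.lam_pos).const_mul _

theorem integral_clockDensity : ∫ t in Ioi (0 : ℝ), D.clockDensity t = 1 := by
  simp only [clockDensity]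
  rw [integral_const_mul, integral_exp_mul_Ioi (neg_lt_zero.2 D.lam_pos)]
  simp [D.lam_pos.ne']

end Clock

section Transition

/-- The integrand of `transitionOp`: the expectation of `g` after a jump at time `t`, weighted by
the density of the jump time. -/
def transitionIntegrand (g : D.M × E → ℝ) (z : D.M × E) (t : ℝ) : ℝ :=
  D.flowOp t.toNNReal (D.jumpOp g) z * D.clockDensity t

theorem transitionIntegrand_nonneg {g : D.M × E → ℝ} (hg : 0 ≤ g) (z : D.M × E) :
    0 ≤ D.transitionIntegrand g z := fun t =>
  mul_nonneg (D.jumpOp_nonneg hg _) (D.clockDensity_pos t).le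

theorem norm_transitionIntegrand_le {g : D.M × E → ℝ} {C : ℝ} (hg : ∀ z, |g z| ≤ C) (z : D.M × E)
    (t : ℝ) : ‖D.transitionIntegrand g z t‖ ≤ C * D.clockDensity t := by
  have hw := (D.clockDensity_pos t).le
  rw [transitionIntegrand, norm_mul, Real.norm_of_nonneg hw]
  exact mul_le_mul_of_nonneg_right (D.abs_jumpOp_le hg _) hw

theorem transitionIntegrand_add (f g : D.M × E → ℝ) (z : D.M × E) :
    D.transitionIntegrand (f + g) z = D.transitionIntegrand f z + D.transitionIntegrand g z := by
  ext t
  simp only [transitionIntegrand, flowOp, jumpOp_add, Pi.add_apply, add_mul]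

theorem transitionIntegrand_smul (c : ℝ) (g : D.M × E → ℝ) (z : D.M × E) :
    D.transitionIntegrand (c • g) z = c • D.transitionIntegrand g z := by
  ext t
  simp only [transitionIntegrand, flowOp, jumpOp_smul, Pi.smul_apply, smul_eq_mul, mul_assoc]

theorem transitionOp_smul (c : ℝ) (g : D.M × E → ℝ) :
    D.transitionOp (c • g) = c • D.transitionOp g := by
  ext z
  change ∫ t in Ioi 0, D.transitionIntegrand (c • g) z t =
    c * ∫ t in Ioi 0, D.transitionIntegrand g z t
  rw [transitionIntegrand_smul, ← integral_const_mul]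
  rfl

theorem transitionOp_one : D.transitionOp 1 = 1 := by
  ext z
  simp only [transitionOp, jumpOp_one, flowOp, Pi.one_apply, one_mul]
  exact D.integral_clockDensity

theorem transitionOp_nonneg {g : D.M × E → ℝ} (hg : 0 ≤ g) : 0 ≤ D.transitionOp g := fun z =>
  integral_nonneg (D.transitionIntegrand_nonneg hg z)

variable [TopologicalSpace E] [DiscreteTopology E]

theorem continuous_jumpOp {g : D.M × E → ℝ} (hg : Continuous g) : Continuous (D.jumpOp g) := by
  rw [continuous_prod_of_discrete_right]
  exact fun i => continuous_finsetSum _ fun j _ => (D.continuous_Q i j).mul (by fun_prop)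

theorem continuous_flowOp_space (t : ℝ≥0) {g : D.M × E → ℝ} (hg : Continuous g) :
    Continuous (D.flowOp t g) := by
  rw [continuous_prod_of_discrete_right]
  exact fun i => hg.comp ((D.continuous_Phi_space i t).prodMk continuous_const)

theorem continuous_transitionIntegrand_space {g : D.M × E → ℝ} (hg : Continuous g) (t : ℝ) :
    Continuous fun z => D.transitionIntegrand g z t :=
  (D.continuous_flowOp_space _ (D.continuous_jumpOp hg)).mul continuous_const

theorem continuous_transitionIntegrand_time {g : D.M × E → ℝ} (hg : Continuous g)
    (z : D.M × E) : Continuous (D.transitionIntegrand g z) := by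
  have hPhi : Continuous fun t : ℝ => D.Phi z.2 t.toNNReal z.1 :=
    (D.continuous_Phi_time z.2 z.1).comp continuous_real_toNNReal
  exact ((D.continuous_jumpOp hg).comp (hPhi.prodMk continuous_const)).mul
    D.continuous_clockDensity

theorem integrableOn_transitionIntegrand (g : C(D.M × E, ℝ)) (z : D.M × E) :
    IntegrableOn (D.transitionIntegrand g z) (Ioi 0) :=
  (D.integrableOn_clockDensity.const_mul ‖g‖).mono'
    (D.continuous_transitionIntegrand_time g.continuous z).aestronglyMeasurable
    (Eventually.of_forall (D.norm_transitionIntegrand_le g.norm_coe_le_norm z))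

theorem continuous_transitionOp (g : C(D.M × E, ℝ)) : Continuous (D.transitionOp g) :=
  continuous_of_dominated
    (fun z => (D.continuous_transitionIntegrand_time g.continuous z).aestronglyMeasurable)
    (fun z => Eventually.of_forall (D.norm_transitionIntegrand_le g.norm_coe_le_norm z))
    (D.integrableOn_clockDensity.const_mul ‖g‖)
    (Eventually.of_forall (D.continuous_transitionIntegrand_space g.continuous))

theorem transitionOp_add (f g : C(D.M × E, ℝ)) :
    D.transitionOp (f + g : C(D.M × E, ℝ)) = D.transitionOp f + D.transitionOp g := by
  ext z
  change ∫ t in Ioi 0, D.transitionIntegrand (f + g) z t = _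
  rw [transitionIntegrand_add]
  exact integral_add (D.integrableOn_transitionIntegrand f z)
    (D.integrableOn_transitionIntegrand g z)

/-- The transition operator of the embedded chain as a positive operator on `C(M × E, ℝ)`, which
it preserves because the chain is Feller. -/
def transition : C(D.M × E, ℝ) →ₚ[ℝ] C(D.M × E, ℝ) :=
  PositiveLinearMap.mk₀
    { toFun g := ⟨D.transitionOp g, D.continuous_transitionOp g⟩
      map_add' f g := DFunLike.coe_injective (D.transitionOp_add f g)
      map_smul' c g := DFunLike.coe_injective (D.transitionOp_smul c g) }
    fun _ hg => D.transitionOp_nonneg hg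

theorem transition_apply (g : C(D.M × E, ℝ)) (z : D.M × E) :
    D.transition g z = D.transitionOp g z := rfl

theorem transition_one : D.transition 1 = 1 := DFunLike.coe_injective D.transitionOp_one

end Transition

section PositivelyInvariant

/-- A subset of `M` is positively invariant if none of the flows leaves it in positive time. -/
def IsPositivelyInvariant (K : Set D.M) : Prop := ∀ i t, MapsTo (D.Phi i t) K K

variable {D} {K : Set D.M}

theorem IsPositivelyInvariant.composite_mem (hK : D.IsPositivelyInvariant K)
    (l : List (E × ℝ≥0)) {x : D.M} (hx : x ∈ K) : D.composite l x ∈ K := by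
  induction l generalizing x with
  | nil => exact hx
  | cons p _ ih => exact ih (hK p.1 p.2 hx)

theorem IsPositivelyInvariant.isAbsorbing_preimage_fst [TopologicalSpace E] [DiscreteTopology E]
    (hK : D.IsPositivelyInvariant K) : IsAbsorbing D.transition (Prod.fst ⁻¹' K) := by
  intro f g hfg z hz
  have hjump (t : ℝ≥0) : D.flowOp t (D.jumpOp f) z = D.flowOp t (D.jumpOp g) z :=
    Finset.sum_congr rfl fun j _ => congrArg _ (hfg (hK z.2 t hz))
  simp only [transition_apply, transitionOp, hjump]

variable (D)

theorem composite_append_singleton (l : List (E × ℝ≥0)) (p : E × ℝ≥0) (x : D.M) :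
    D.composite (l ++ [p]) x = D.Phi p.1 p.2 (D.composite l x) := by
  simp [composite]

/-- The closure of the positive orbit `γ⁺(y)`, as a subset of `M`. -/
def orbitClosure (y : D.M) : Set D.M := closure {x | ∃ l ≠ [], D.composite l y = x}

theorem mem_orbitClosure_iff {x y : D.M} :
    x ∈ D.orbitClosure y ↔ (x : EuclideanSpace ℝ (Fin d)) ∈ closure (D.orbit y) := by
  have himage : D.orbit y = Subtype.val '' {x | ∃ l ≠ [], D.composite l y = x} := by
    ext z
    simp only [orbit, mem_ofPred_eq, mem_image, exists_exists_and_eq_and]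
  rw [orbitClosure, closure_subtype, himage]

theorem accessibleProd_eq_iInter : D.accessibleProd = ⋂ y, Prod.fst ⁻¹' D.orbitClosure y := by
  ext z
  simp [accessibleProd, accessible, mem_orbitClosure_iff]

theorem orbitClosure_nonempty [Nonempty E] (y : D.M) : (D.orbitClosure y).Nonempty := by
  obtain ⟨i⟩ := ‹Nonempty E›
  exact ⟨_, subset_closure ⟨[(i, 0)], by simp, rfl⟩⟩

theorem isPositivelyInvariant_orbitClosure (y : D.M) :
    D.IsPositivelyInvariant (D.orbitClosure y) := by
  intro i t
  refine MapsTo.closure ?_ (D.continuous_Phi_space i t)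
  rintro _ ⟨l, -, rfl⟩
  exact ⟨l ++ [(i, t)], by simp, D.composite_append_singleton l (i, t) y⟩

variable {D}

theorem IsPositivelyInvariant.orbitClosure_subset (hK : D.IsPositivelyInvariant K)
    (hKc : IsClosed K) {y : D.M} (hy : y ∈ K) : D.orbitClosure y ⊆ K :=
  closure_minimal (by rintro _ ⟨l, -, rfl⟩; exact hK.composite_mem l hy) hKc

end PositivelyInvariant

section AbsorbingSets

variable [TopologicalSpace E] [DiscreteTopology E] {D} {S : Set (D.M × E)} {x : D.M} {i j : E}

theorem eq_zero_of_transition_eq_zero {g : C(D.M × E, ℝ)} (hg : 0 ≤ g)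
    (h : D.transition g (x, i) = 0) (t : ℝ≥0) (hQ : 0 < D.Q (D.Phi i t x) i j) :
    g (D.Phi i t x, j) = 0 := by
  have hzero : D.transitionIntegrand g (x, i) t = 0 := eqOn_Ici_zero_of_setIntegral_Ioi_eq_zero
    (D.continuous_transitionIntegrand_time g.continuous (x, i))
    (D.transitionIntegrand_nonneg hg (x, i)) (D.integrableOn_transitionIntegrand g (x, i)) h t.2
  have hjump := (mul_eq_zero.1 hzero).resolve_right (D.clockDensity_pos t).ne'
  rw [Real.toNNReal_coe] at hjump
  exact D.eq_zero_of_jumpOp_eq_zero hg hjump hQ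

theorem Phi_mem_of_isAbsorbing (hS : IsClosed S) (hA : IsAbsorbing D.transition S)
    (hx : (x, i) ∈ S) (t : ℝ≥0) (hQ : 0 < D.Q (D.Phi i t x) i j) : (D.Phi i t x, j) ∈ S := by
  by_contra hj
  obtain ⟨g, hg, hgS, hgj⟩ := exists_nonneg_eqOn_zero_of_notMem hS hj
  have hzero : D.transition g (x, i) = 0 := by
    rw [hA (g := 0) hgS hx, map_zero, ContinuousMap.zero_apply]
  exact one_ne_zero (hgj.symm.trans (eq_zero_of_transition_eq_zero hg hzero t hQ))

theorem mk_mem_of_isAbsorbing (hS : IsClosed S) (hA : IsAbsorbing D.transition S)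
    (hx : (x, i) ∈ S) (j : E) : (x, j) ∈ S := by
  induction D.rate_irreducible x i j with
  | refl => exact hx
  | @tail k l _ hrate ih =>
    have hQ : 0 < D.Q (D.Phi k 0 x) k l := by
      rw [D.Phi_zero]
      exact D.Q_pos_of_rate_pos hrate
    simpa only [D.Phi_zero] using Phi_mem_of_isAbsorbing hS hA ih 0 hQ

theorem isPositivelyInvariant_fiber_of_isAbsorbing (hS : IsClosed S)
    (hA : IsAbsorbing D.transition S) (j : E) : D.IsPositivelyInvariant {x | (x, j) ∈ S} :=
  fun i t _ hx => mk_mem_of_isAbsorbing hS hA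
    (Phi_mem_of_isAbsorbing hS hA (mk_mem_of_isAbsorbing hS hA hx i) t (D.Q_self_pos _ i)) j

variable (D)

theorem sInter_closedAbsorbingSets : ⋂₀ closedAbsorbingSets D.transition = D.accessibleProd := by
  rw [accessibleProd_eq_iInter]
  refine Subset.antisymm (subset_iInter fun y z hz => hz _ ⟨?_, ?_, ?_⟩)
    (subset_sInter fun S ⟨hS, ⟨⟨y, i⟩, hy⟩, hA⟩ => ?_)
  · exact isClosed_closure.preimage continuous_fst
  · have : Nonempty E := ⟨z.2⟩
    exact (D.orbitClosure_nonempty y).preimage Prod.fst_surjective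
  · exact (D.isPositivelyInvariant_orbitClosure y).isAbsorbing_preimage_fst
  · rintro ⟨x, j⟩ hx
    exact (isPositivelyInvariant_fiber_of_isAbsorbing hS hA j).orbitClosure_subset
      (hS.preimage (by fun_prop)) (mk_mem_of_isAbsorbing hS hA hy j) (mem_iInter.1 hx y)

theorem isLeast_accessibleProd (hne : D.accessibleProd.Nonempty) :
    IsLeast (closedAbsorbingSets D.transition) D.accessibleProd := by
  refine ⟨⟨?_, hne, ?_⟩, fun S hS => ?_⟩
  · rw [accessibleProd_eq_iInter]
    exact isClosed_iInter fun y => isClosed_closure.preimage continuous_fst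
  · rw [accessibleProd_eq_iInter, ← preimage_iInter]
    refine IsPositivelyInvariant.isAbsorbing_preimage_fst fun i t x hx => mem_iInter.2 fun y => ?_
    exact D.isPositivelyInvariant_orbitClosure y i t (mem_iInter.1 hx y)
  · rw [← sInter_closedAbsorbingSets]
    exact sInter_subset_of_mem hS

end AbsorbingSets

section Accessible

variable {D}

theorem nonempty_of_accessible_nonempty (hne : D.accessible.Nonempty) : Nonempty E := by
  obtain ⟨p, hpM, hp⟩ := hne
  obtain ⟨_, l, hl, -⟩ := closure_nonempty_iff.1 ⟨p, mem_iInter.1 hp ⟨p, hpM⟩⟩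
  exact ⟨(l.head hl).1⟩

theorem accessibleProd_nonempty (hne : D.accessible.Nonempty) : D.accessibleProd.Nonempty := by
  obtain ⟨i⟩ := nonempty_of_accessible_nonempty hne
  obtain ⟨p, hp⟩ := hne
  exact ⟨(⟨p, hp.1⟩, i), hp⟩

theorem interior_accessibleProd_nonempty [TopologicalSpace E]
    (hne : (interior D.accessible).Nonempty) : (interior D.accessibleProd).Nonempty := by
  obtain ⟨i⟩ := nonempty_of_accessible_nonempty (hne.mono interior_subset)
  obtain ⟨p, hp⟩ := hne
  have hcont : Continuous fun z : D.M × E => (z.1 : EuclideanSpace ℝ (Fin d)) := by fun_prop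
  exact ⟨(⟨p, (interior_subset hp).1⟩, i), preimage_interior_subset_interior_preimage hcont hp⟩

end Accessible

end Model

end SwitchedPDMP

end

open SwitchedPDMP SwitchedPDMP.Model

theorem mainTheorem7 {d : ℕ} {E : Type*} [Fintype E] [TopologicalSpace E] [DiscreteTopology E]
    [MeasurableSpace E] [BorelSpace E] (D : SwitchedPDMP.Model d E) :
    (D.accessible.Nonempty →
      (∀ μ : Measure (D.M × E), D.IsInvariant μ → D.accessibleProd ⊆ μ.support) ∧
      ∃ μ : Measure (D.M × E), D.IsInvariant μ ∧ μ.support = D.accessibleProd) ∧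
    ((interior D.accessible).Nonempty →
      ∀ μ : Measure (D.M × E), D.IsInvariant μ → μ.support = D.accessibleProd) ∧
    (D.IsStable →
      ∀ π : Measure (D.M × E), D.IsInvariant π → π.support = D.accessibleProd) := by
  have hsupp (μ : Measure (D.M × E)) (hμ : D.IsInvariant μ) :
      μ.support ∈ closedAbsorbingSets D.transition :=
    have := hμ.1
    IsInvariantMeasure.support_mem_closedAbsorbingSets hμ.2 (IsProbabilityMeasure.ne_zero μ)
  refine ⟨fun hne => ?_, fun hint μ hμ => ?_, fun hstable π hπ => ?_⟩
  · have hleast := D.isLeast_accessibleProd (accessibleProd_nonempty hne)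
    obtain ⟨hcl, hne', hA⟩ := hleast.1
    obtain ⟨μ, hprob, hμ, hμsub⟩ :=
      hA.exists_isInvariantMeasure_support_subset D.transition_one hcl hne'
    exact ⟨fun ν hν => hleast.2 (hsupp ν hν), μ, ⟨hprob, hμ⟩,
      hμsub.antisymm (hleast.2 (hsupp μ ⟨hprob, hμ⟩))⟩
  · have := hμ.1
    exact IsInvariantMeasure.support_eq_of_isLeast D.transition_one hμ.2
      (IsProbabilityMeasure.ne_zero μ)
      (D.isLeast_accessibleProd (accessibleProd_nonempty (hint.mono interior_subset)))
      (interior_accessibleProd_nonempty hint)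
  · have := hπ.1
    have hleast := isLeast_support_of_unique_isInvariantMeasure D.transition_one hπ.2
      fun ν hprob hν => hstable.unique ⟨hprob, hν⟩ hπ
    rw [← hleast.isGLB.sInf_eq, sInf_eq_sInter, D.sInter_closedAbsorbingSets]
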